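/- A numerical semigroup is a submonoid $\mathcal S$ of $(\mathbb N,+)$ with finite complement in $\mathbb N$. Its unique minimal set of generators is its set of atoms. A factorization of $x\in\mathcal S$ is an expression of $x$ as a sum $\sum_a\lambda_a a$ of atoms $a$ with multiplicities $\lambda_a\in\mathbb N$, and its length is $\sum_a\lambda_a$. Let $\mathcal L_{\mathcal S}$ be the set of all $x\in\mathcal S$ having at least two different factorizations of the same length. Theorem. Let $n\ge 2$, let $m_1<\dots<m_n$ be positive integers with $m_i=m_1+(i-1)e$ for $1\le i\le n$ (so $e\geq 1$), and let $b$ be a positive integer with $b\notin\{m_1,\dots,m_n\}$. Suppose that $\mathcal A=\{m_1,\dots,m_n,b\}$ is the minimal set of generators of a numerical semigroup $\mathcal S$. Put $M=\max\mathcal A$, $m=\min\mathcal A$, $d=\gcd(b-m_1,e)$, $\beta=\left\lfloor\frac{M-m-d}{d(n-1)}\right\rfloor$ and $$H=\{2m_1+\lambda e \mid \lambda\in\mathbb N,\ 2\le\lambda\le 2n-4\}+\mathcal S$$ (so $H=\emptyset$ if $n=2$). (I) Suppose that $b\in\{m,M\}$. 1. If $d(n-1)$ divides $M-m$, then $\mathcal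 L_{\mathcal S}=H\cup\big((\beta+1)m_1+\mathcal S\big)$ when $b=m$, and $\mathcal L_{\mathcal S}=H\cup\big((\beta+1)m_n+\mathcal S\big)$ when $b=M$. 2. If $d(n-1)$ does not divide $M-m$, then $\mathcal L_{\mathcal S}=H\cup\big(\{(\beta+1)m_1,\ (\beta+1)m_1+e\}+\mathcal S\big)$ when $b=m$, and $\mathcal L_{\mathcal S}=H\cup\big(\{(\beta+1)m_n,\ (\beta+1)m_n-e\}+\mathcal S\big)$ when $b=M$. (II) Suppose that $b\notin\{m,M\}$. Then $\mathcal L_{\mathcal S}=H\cup\big(\frac{e}{d}\,b+\mathcal S\big)$. -/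

import Mathlib

open scoped Pointwise

/-- A numerical semigroup: a submonoid of `ℕ` with finite complement. -/
def IsNumericalSemigroup (S : AddSubmonoid ℕ) : Prop :=
  ((S : Set ℕ)ᶜ).Finite

/-- `A` is a minimal (with respect to inclusion) set of generators of `S`. -/
def IsMinimalGeneratingSet (A : Set ℕ) (S : AddSubmonoid ℕ) : Prop :=
  AddSubmonoid.closure A = S ∧ ∀ a ∈ A, a ∉ AddSubmonoid.closure (A \ {a})

/-- The atoms (irreducible elements) of a submonoid `S` of `ℕ`. As `0` is the only invertible
element, they are the nonzero elements of `S` that are not a sum of two nonzero elements of `S`;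
they form the unique minimal set of generators of `S`. -/
def atomsOf (S : AddSubmonoid ℕ) : Set ℕ :=
  {a | a ∈ S ∧ a ≠ 0 ∧ ∀ x ∈ S, ∀ y ∈ S, a = x + y → x = 0 ∨ y = 0}

/-- `f` is a factorization of `x` in `S`: `f a` is the multiplicity of the atom `a`, and
`x = ∑ f a * a`. -/
def IsFactorization (S : AddSubmonoid ℕ) (f : ℕ →₀ ℕ) (x : ℕ) : Prop :=
  (f.support : Set ℕ) ⊆ atomsOf S ∧ f.sum (fun a k => k * a) = x

/-- The length of a factorization: the total number of atoms used. -/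
def factorizationLength (f : ℕ →₀ ℕ) : ℕ :=
  f.sum (fun _ k => k)

/-- The set `𝓛_S` of elements of `S` with at least two different factorizations of the same
length. -/
def sameLengthSet (S : AddSubmonoid ℕ) : Set ℕ :=
  {x | x ∈ S ∧ ∃ f g : ℕ →₀ ℕ, IsFactorization S f x ∧ IsFactorization S g x ∧
    f ≠ g ∧ factorizationLength f = factorizationLength g}

/-- The set of generators `{m_1, …, m_n, b}`. -/
def generatorSet (n : ℕ) (m : ℕ → ℕ) (b : ℕ) : Set ℕ :=
  insert b (m '' Set.Icc 1 n)

/-! Put N = n - 1 and encode a factorization as k copies of b together with a multiset s of indices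
in [0, N]; its value depends only on k, the cardinality of s and the sum of s. Compare two
factorizations of x of equal length.

If both use b equally often, the index multisets differ but share cardinality and sum. This forces a
pair i, j in s with 2 ≤ i + j ≤ 2N - 2 (`Multiset.exists_pair_of_ne`), so x ∈ H. Otherwise write b =
p + δγ and ε = δe' with γ, e' coprime: the numbers of copies of b differ by e't with t > 0, and the
index sums by tγ (`exists_reps`).

If b lies inside the progression, then e' = e/d copies of b split off, and e'b is itself a sum of e'
terms. If b lies outside, γ = -c with c > 0, and the side richer in b needs at least Q = ⌈c/N⌉
progression terms. The other side then has at least e' + Q terms and, off H, its index sum is at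
most 1: it is all zeros, or zeros and a single 1. This gives the generators, with β + 1 = e' + Q.
The case b = M is the case b = m for the progression read backwards, with step -e. -/

theorem atomsOf_eq_of_isMinimalGeneratingSet {A : Set ℕ} {S : AddSubmonoid ℕ}
    (h : IsMinimalGeneratingSet A S) : atomsOf S = A := by
  obtain ⟨hcl, hmin⟩ := h
  ext a
  constructor
  · rintro ⟨haS, ha0, hat⟩
    -- Splitting off one nonzero generator: for an atom, the cofactor must vanish.
    have key : ∀ x ∈ AddSubmonoid.closure A, x = 0 ∨ ∃ g ∈ A, g ≠ 0 ∧ ∃ y ∈ S, x = g + y := by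
      intro x hx
      induction hx using AddSubmonoid.closure_induction with
      | mem x hx =>
        by_cases h0 : x = 0
        · exact Or.inl h0
        · exact Or.inr ⟨x, hx, h0, 0, S.zero_mem, by simp⟩
      | zero => exact Or.inl rfl
      | add x y hx hy ihx ihy =>
        rcases ihx with rfl | ⟨g, hg, hg0, z, hz, rfl⟩
        · simpa using ihy
        · refine Or.inr ⟨g, hg, hg0, z + y, S.add_mem hz (hcl ▸ hy), by ring⟩
    rcases key a (hcl ▸ haS) with h0 | ⟨g, hg, hg0, y, hy, rfl⟩
    · exact absurd h0 ha0
    · have hgS : g ∈ S := hcl ▸ AddSubmonoid.subset_closure hg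
      rcases hat g hgS y hy rfl with h | h
      · exact absurd h hg0
      · simpa [h] using hg
  · intro ha
    refine ⟨hcl ▸ AddSubmonoid.subset_closure ha, ?_, ?_⟩
    · rintro rfl
      exact hmin 0 ha (AddSubmonoid.zero_mem _)
    · intro x hx y hy hxy
      by_contra! hne
      -- Elements below a cannot involve a, so a proper splitting of a would make the generator a
      -- redundant.
      have key : ∀ z ∈ AddSubmonoid.closure A, z < a → z ∈ AddSubmonoid.closure (A \ {a}) := by
        intro z hz
        induction hz using AddSubmonoid.closure_induction with
        | mem z hz => exact fun hlt => AddSubmonoid.subset_closure ⟨hz, by simpa using hlt.ne⟩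
        | zero => exact fun _ => AddSubmonoid.zero_mem _
        | add u v hu hv ihu ihv =>
          exact fun hlt => AddSubmonoid.add_mem _ (ihu (by omega)) (ihv (by omega))
      apply hmin a ha
      have hx' := key x (hcl ▸ hx) (by omega)
      have hy' := key y (hcl ▸ hy) (by omega)
      have := AddSubmonoid.add_mem _ hx' hy'
      rwa [← hxy] at this

/-! ### Multisets of indices in [0, N] with given cardinality and sum. -/

namespace Multiset

theorem card_le_count_zero_add_sum (s : Multiset ℕ) : card s ≤ s.count 0 + s.sum := by
  induction s using Multiset.induction with
  | empty => simp
  | cons a s ih =>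
    rcases Nat.eq_zero_or_pos a with rfl | ha
    · simp; omega
    · rw [card_cons, sum_cons, count_cons_of_ne ha.ne]; omega

theorem sum_le_mul_card {N : ℕ} {s : Multiset ℕ} (hs : ∀ i ∈ s, i ≤ N) :
    s.sum ≤ N * card s := by
  simpa [mul_comm] using Multiset.sum_le_card_nsmul s N hs

theorem exists_card_sum_eq {N : ℕ} (k c : ℕ) (h : c ≤ N * k) :
    ∃ s : Multiset ℕ, (∀ i ∈ s, i ≤ N) ∧ card s = k ∧ s.sum = c := by
  induction k generalizing c with
  | zero => exact ⟨0, by simp, by simp, by simp at h ⊢; omega⟩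
  | succ k ih =>
    obtain ⟨s, h1, h2, h3⟩ := ih (c - min c N) (by rw [mul_add] at h; omega)
    refine ⟨min c N ::ₘ s, ?_, by simp [h2], ?_⟩
    · intro i hi
      rcases mem_cons.1 hi with rfl | hi
      · exact min_le_right _ _
      · exact h1 i hi
    · rw [sum_cons, h3]; omega

/-- A multiset of at least two elements of `[0, N]` either contains two elements whose sum lies in
`[2, 2N - 2]`, or its sum is extremal up to one. -/
theorem exists_pair_or_sum_extremal {N : ℕ} (hN : 2 ≤ N) {s : Multiset ℕ}
    (hs : ∀ i ∈ s, i ≤ N) (hcard : 2 ≤ card s) :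
    (∃ i j t, s = i ::ₘ j ::ₘ t ∧ 2 ≤ i + j ∧ i + j ≤ 2 * N - 2) ∨
      s.sum ≤ 1 ∨ N * card s ≤ s.sum + 1 := by
  by_contra! hcon
  obtain ⟨hpair, hlow, hhigh⟩ := hcon
  have hpair' : ∀ i t j, s = i ::ₘ t → j ∈ t → i + j ≤ 1 ∨ 2 * N - 2 < i + j := by
    intro i t j h hj
    obtain ⟨u, rfl⟩ := exists_cons_of_mem hj
    by_contra! h'
    have := hpair i j u h (by omega)
    omega
  by_cases hNs : N ∈ s
  -- Some i < N exists; pairing it with N forces i = N - 1, and then every other element is N, so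
  -- the sum is N * card s - 1.
  · have : ∃ i ∈ s, i < N := by
      by_contra! h
      have := Multiset.card_nsmul_le_sum (s := s) (a := N) (fun i hi => h i hi)
      rw [smul_eq_mul, mul_comm] at this
      omega
    obtain ⟨i, hi, hiN⟩ := this
    obtain ⟨t, rfl⟩ := exists_cons_of_mem hi
    have hNt : N ∈ t := by
      rcases mem_cons.1 hNs with h | h
      · omega
      · exact h
    have h1 := hpair' i t N rfl hNt
    have h2 : card t • N ≤ t.sum := card_nsmul_le_sum fun j hj => by
      have h3 := hpair' i t j rfl hj
      have := hs j (mem_cons_of_mem hj)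
      by_cases hjN : j = N
      · exact hjN.ge
      · obtain ⟨u, hu⟩ := exists_cons_of_mem (mem_cons_of_mem hj : j ∈ i ::ₘ t)
        have hNu : N ∈ u := by
          rcases mem_cons.1 (hu ▸ hNs) with h | h
          · exact absurd h.symm hjN
          · exact h
        have h4 := hpair' j u N hu hNu
        omega
    rw [smul_eq_mul, mul_comm] at h2
    rw [card_cons, sum_cons, mul_add] at hhigh
    omega
  -- Without N all pair sums are at most 2N - 2, hence at most 1: one element is 1 and the rest are
  -- 0.
  · have : ∃ i ∈ s, 1 ≤ i := by
      by_contra! h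
      have := Multiset.sum_le_card_nsmul s 0 (fun i hi => by have := h i hi; omega)
      simp at this
      omega
    obtain ⟨i, hi, hi1⟩ := this
    have hlt : ∀ j ∈ s, j < N := fun j hj =>
      lt_of_le_of_ne (hs j hj) (fun h => hNs (h ▸ hj))
    obtain ⟨t, rfl⟩ := exists_cons_of_mem hi
    have hiN := hlt i hi
    have ht : ∀ j ∈ t, i = 1 ∧ j ≤ 0 := by
      intro j hj
      have h3 := hpair' i t j rfl hj
      have := hlt j (mem_cons_of_mem hj)
      omega
    have h2 := Multiset.sum_le_card_nsmul t 0 (fun j hj => (ht j hj).2)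
    obtain ⟨j, hj⟩ := card_pos_iff_exists_mem.1 (show 0 < card t by rw [card_cons] at hcard; omega)
    have := (ht j hj).1
    simp at h2 hlow
    omega

/-- The sum counts the ones and the cardinality then fixes the zeros. Settles N = 1 and the low
extremal case. -/
theorem eq_of_card_eq_of_sum_eq_of_le_one {s t : Multiset ℕ} (hs : ∀ i ∈ s, i ≤ 1)
    (ht : ∀ i ∈ t, i ≤ 1) (hc : card s = card t) (hsum : s.sum = t.sum) : s = t := by
  induction s using Multiset.induction generalizing t with
  | empty => exact (card_eq_zero.1 (by simpa using hc.symm)).symm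
  | cons a s ih =>
    have hat : a ∈ t := by
      by_contra hat
      have h1 := hs a (mem_cons_self _ _)
      have h2 := sum_le_mul_card fun i hi => hs i (mem_cons_of_mem (a := i) (b := a) hi)
      rcases Nat.le_one_iff_eq_zero_or_eq_one.1 h1 with rfl | rfl
      · have := card_nsmul_le_sum (s := t) (a := 1) fun i hi =>
          Nat.one_le_iff_ne_zero.2 fun h => hat (h ▸ hi)
        simp at this hc hsum; omega
      · have := sum_le_card_nsmul t 0 fun i hi => by
          have := ht i hi
          have : i ≠ 1 := fun h => hat (h ▸ hi)
          omega
        simp at this hsum; omega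
    obtain ⟨u, rfl⟩ := exists_cons_of_mem hat
    rw [ih (fun i hi => hs i (mem_cons_of_mem hi)) (fun i hi => ht i (mem_cons_of_mem hi))
      (by simpa using hc) (by simpa using hsum)]

theorem eq_of_sum_le_one {s t : Multiset ℕ} (hc : card s = card t) (hsum : s.sum = t.sum)
    (h : s.sum ≤ 1) : s = t :=
  eq_of_card_eq_of_sum_eq_of_le_one (fun _ hi => (single_le_sum (by simp) _ hi).trans h)
    (fun _ hi => (single_le_sum (by simp) _ hi).trans (hsum ▸ h)) hc hsum

theorem sum_map_sub_add_sum {N : ℕ} {s : Multiset ℕ} (hs : ∀ i ∈ s, i ≤ N) :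
    (s.map (N - ·)).sum + s.sum = N * card s := by
  induction s using Multiset.induction with
  | empty => simp
  | cons a s ih =>
    have := ih fun i hi => hs i (mem_cons_of_mem hi)
    have := hs a (mem_cons_self _ _)
    simp [mul_add] at *; omega

/-- The reflection i ↦ N - i turns the high extremal case into the low one. -/
theorem eq_of_mul_card_le_sum {N : ℕ} {s t : Multiset ℕ} (hs : ∀ i ∈ s, i ≤ N)
    (ht : ∀ i ∈ t, i ≤ N) (hc : card s = card t) (hsum : s.sum = t.sum)
    (h : N * card s ≤ s.sum + 1) : s = t := by
  have h1 := sum_map_sub_add_sum hs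
  have h2 := sum_map_sub_add_sum ht
  rw [← hc] at h2
  have h3 : s.map (N - ·) = t.map (N - ·) :=
    eq_of_sum_le_one (by simpa using hc) (by omega) (by omega)
  have inv : ∀ u : Multiset ℕ, (∀ i ∈ u, i ≤ N) → (u.map (N - ·)).map (N - ·) = u := by
    intro u hu
    rw [map_map]
    conv_rhs => rw [← map_id u]
    exact map_congr rfl fun i hi => by have := hu i hi; simp; omega
  rw [← inv s hs, h3, inv t ht]

/-- Two different multisets in `[0, N]` with the same cardinality and sum contain a pair that can be
exchanged. -/
theorem exists_pair_of_ne {N : ℕ} (hN : 1 ≤ N) {s t : Multiset ℕ} (hs : ∀ i ∈ s, i ≤ N)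
    (ht : ∀ i ∈ t, i ≤ N) (hc : card s = card t) (hsum : s.sum = t.sum) (hne : s ≠ t) :
    ∃ i j u, s = i ::ₘ j ::ₘ u ∧ 2 ≤ i + j ∧ i + j ≤ 2 * N - 2 := by
  have hN2 : 2 ≤ N := by
    by_contra h
    obtain rfl : N = 1 := by omega
    exact hne (eq_of_card_eq_of_sum_eq_of_le_one hs ht hc hsum)
  have hcard : 2 ≤ card s := by
    by_contra! h
    rcases (show card s = 0 ∨ card s = 1 by omega) with h0 | h1
    · exact hne ((card_eq_zero.1 h0).trans (card_eq_zero.1 (hc ▸ h0)).symm)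
    · obtain ⟨i, rfl⟩ := card_eq_one.1 h1
      obtain ⟨j, rfl⟩ := card_eq_one.1 (hc ▸ h1)
      simp at hsum
      exact hne (by rw [hsum])
  rcases exists_pair_or_sum_extremal hN2 hs hcard with h | h | h
  · exact h
  · exact absurd (eq_of_sum_le_one hc hsum h) hne
  · exact absurd (eq_of_mul_card_le_sum hs ht hc hsum h) hne

end Multiset

/-! ### Factorizations over a progression and one extra generator. -/

/-- `S` is generated by its atoms, which are `b` and the terms `ν i = p + i * ε` (`i ≤ N`) of an
arithmetic progression of step `ε` (possibly negative). -/
structure IsProgressionSemigroup (S : AddSubmonoid ℕ) (N : ℕ) (ν : ℕ → ℕ) (p ε : ℤ) (b : ℕ) :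
    Prop where
  step_ne : ε ≠ 0
  val : ∀ i ≤ N, (ν i : ℤ) = p + i * ε
  ne : ∀ i ≤ N, ν i ≠ b
  atoms : atomsOf S = insert b (ν '' Set.Iic N)
  closure : AddSubmonoid.closure (insert b (ν '' Set.Iic N)) = S

/-- `x` is the sum of `k` copies of `b` and of the terms `p + i * ε` for `i ∈ s`. -/
def IsProgressionRep (N : ℕ) (p ε : ℤ) (b x k : ℕ) (s : Multiset ℕ) : Prop :=
  (∀ i ∈ s, i ≤ N) ∧ (x : ℤ) = k * b + Multiset.card s * p + s.sum * ε

/-- The sums of two terms of the progression whose indices add up to a number in `[2, 2N - 2]`. -/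
def exchangeablePairs (N : ℕ) (ν : ℕ → ℕ) : Set ℕ :=
  {x | ∃ i ≤ N, ∃ j ≤ N, 2 ≤ i + j ∧ i + j ≤ 2 * N - 2 ∧ x = ν i + ν j}

theorem mem_sameLengthSet_iff_multiset {S : AddSubmonoid ℕ} {x : ℕ} :
    x ∈ sameLengthSet S ↔ ∃ t t' : Multiset ℕ, (∀ a ∈ t, a ∈ atomsOf S) ∧
      (∀ a ∈ t', a ∈ atomsOf S) ∧ t.sum = x ∧ t'.sum = x ∧ t ≠ t' ∧
      Multiset.card t = Multiset.card t' := by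
  have hfact : ∀ f : ℕ →₀ ℕ, IsFactorization S f x ↔
      (∀ a ∈ Finsupp.toMultiset f, a ∈ atomsOf S) ∧ (Finsupp.toMultiset f).sum = x := by
    intro f
    have h2 : (Finsupp.toMultiset f).sum = f.sum (fun a k => k * a) := by
      rw [Finsupp.sum_toMultiset]; rfl
    rw [IsFactorization, h2]
    simp only [Finsupp.mem_toMultiset]
    rfl
  have hlen : ∀ f : ℕ →₀ ℕ, factorizationLength f = Multiset.card (Finsupp.toMultiset f) := by
    intro f
    rw [Finsupp.card_toMultiset]; rfl
  constructor
  · rintro ⟨-, f, g, hf, hg, hne, hl⟩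
    rw [hfact] at hf hg
    rw [hlen, hlen] at hl
    exact ⟨_, _, hf.1, hg.1, hf.2, hg.2, fun h => hne <| by
      rw [← Finsupp.toMultiset_toFinsupp f, h, Finsupp.toMultiset_toFinsupp], hl⟩
  · rintro ⟨t, t', ht, ht', hx, hx', hne, hc⟩
    refine ⟨hx ▸ S.multiset_sum_mem _ fun a ha => (ht a ha).1,
      Multiset.toFinsupp t, Multiset.toFinsupp t', ?_, ?_, ?_, ?_⟩
    · rw [hfact]; simpa using ⟨ht, hx⟩
    · rw [hfact]; simpa using ⟨ht', hx'⟩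
    · exact fun h => hne (Multiset.toFinsupp.injective h)
    · rw [hlen, hlen]; simpa using hc

namespace IsProgressionSemigroup

variable {S : AddSubmonoid ℕ} {N : ℕ} {ν : ℕ → ℕ} {p ε : ℤ} {b : ℕ}

theorem exists_index (h : IsProgressionSemigroup S N ν p ε b) (t : Multiset ℕ)
    (ht : ∀ a ∈ t, a ∈ insert b (ν '' Set.Iic N)) :
    ∃ (k : ℕ) (s : Multiset ℕ), (∀ i ∈ s, i ≤ N) ∧ t = Multiset.replicate k b + s.map ν := by
  induction t using Multiset.induction with
  | empty => exact ⟨0, 0, by simp, by simp⟩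
  | cons a t ih =>
    obtain ⟨k, s, hs, rfl⟩ := ih fun a ha => ht a (Multiset.mem_cons_of_mem ha)
    rcases ht a (Multiset.mem_cons_self _ _) with rfl | ⟨i, hi, rfl⟩
    · exact ⟨k + 1, s, hs, by rw [Multiset.replicate_succ, Multiset.cons_add]⟩
    · refine ⟨k, i ::ₘ s, ?_, by rw [Multiset.map_cons, Multiset.add_cons]⟩
      intro j hj
      rcases Multiset.mem_cons.1 hj with rfl | hj
      · exact hi
      · exact hs j hj

theorem sum_eq (h : IsProgressionSemigroup S N ν p ε b) (k : ℕ) {s : Multiset ℕ}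
    (hs : ∀ i ∈ s, i ≤ N) :
    ((Multiset.replicate k b + s.map ν).sum : ℤ) = k * b + Multiset.card s * p + s.sum * ε := by
  induction s using Multiset.induction with
  | empty => simp
  | cons i s ih =>
    have h1 := ih fun i hi => hs i (Multiset.mem_cons_of_mem hi)
    have h2 := h.val i (hs i (Multiset.mem_cons_self _ _))
    simp only [Multiset.map_cons, Multiset.add_cons, Multiset.sum_cons, Multiset.card_cons]
    push_cast at h1 ⊢
    rw [h1, h2]; ring

theorem index_injective (h : IsProgressionSemigroup S N ν p ε b) {k k' : ℕ} {s s' : Multiset ℕ}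
    (hs : ∀ i ∈ s, i ≤ N) (hs' : ∀ i ∈ s', i ≤ N)
    (heq : Multiset.replicate k b + s.map ν = Multiset.replicate k' b + s'.map ν) :
    k = k' ∧ s = s' := by
  have hb : ∀ u : Multiset ℕ, (∀ i ∈ u, i ≤ N) → (u.map ν).count b = 0 := by
    intro u hu
    rw [Multiset.count_eq_zero]
    simp only [Multiset.mem_map, not_exists, not_and]
    exact fun i hi => h.ne i (hu i hi)
  have hk := congrArg (Multiset.count b) heq
  simp only [Multiset.count_add, hb s hs, hb s' hs', Multiset.count_replicate_self] at hk
  obtain rfl : k = k' := by omega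
  refine ⟨rfl, ?_⟩
  have hm := add_left_cancel heq
  have hz : ∀ u : Multiset ℕ, (∀ i ∈ u, i ≤ N) →
      (u.map ν).map (fun a : ℕ => (a : ℤ)) = u.map (fun i : ℕ => p + i * ε) := by
    intro u hu
    rw [Multiset.map_map]
    exact Multiset.map_congr rfl fun i hi => h.val i (hu i hi)
  -- `ν` is controlled only up to N, whereas the affine formula is injective on all of ℕ.
  have hinj : Function.Injective (fun i : ℕ => p + (i : ℤ) * ε) := by
    intro i j hij
    have := mul_right_cancel₀ h.step_ne (add_left_cancel hij)
    exact_mod_cast this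
  apply Multiset.map_injective hinj
  rw [← hz s hs, ← hz s' hs', hm]

theorem mem_iff (h : IsProgressionSemigroup S N ν p ε b) {x : ℕ} :
    x ∈ S ↔ ∃ k s, IsProgressionRep N p ε b x k s := by
  constructor
  · intro hx
    rw [← h.closure] at hx
    obtain ⟨t, ht, rfl⟩ := AddSubmonoid.exists_multiset_of_mem_closure hx
    obtain ⟨k, s, hs, rfl⟩ := h.exists_index t ht
    exact ⟨k, s, hs, h.sum_eq k hs⟩
  · rintro ⟨k, s, hs, hx⟩
    rw [← h.sum_eq k hs] at hx
    rw [Nat.cast_inj.1 hx, ← h.closure]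
    refine AddSubmonoid.multiset_sum_mem _ _ fun a ha => AddSubmonoid.subset_closure ?_
    rcases Multiset.mem_add.1 ha with ha | ha
    · exact Or.inl (Multiset.eq_of_mem_replicate ha)
    · obtain ⟨i, hi, rfl⟩ := Multiset.mem_map.1 ha
      exact Or.inr ⟨i, hs i hi, rfl⟩

theorem mem_sameLengthSet_iff (h : IsProgressionSemigroup S N ν p ε b) {x : ℕ} :
    x ∈ sameLengthSet S ↔ ∃ k s k' s', IsProgressionRep N p ε b x k s ∧
      IsProgressionRep N p ε b x k' s' ∧ k + Multiset.card s = k' + Multiset.card s' ∧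
      ¬ (k = k' ∧ s = s') := by
  rw [mem_sameLengthSet_iff_multiset, h.atoms]
  constructor
  · rintro ⟨t, t', ht, ht', hx, hx', hne, hc⟩
    obtain ⟨k, s, hs, rfl⟩ := h.exists_index t ht
    obtain ⟨k', s', hs', rfl⟩ := h.exists_index t' ht'
    refine ⟨k, s, k', s', ⟨hs, ?_⟩, ⟨hs', ?_⟩, by simpa using hc, ?_⟩
    · rw [← h.sum_eq k hs, hx]
    · rw [← h.sum_eq k' hs', hx']
    · rintro ⟨rfl, rfl⟩; exact hne rfl
  · rintro ⟨k, s, k', s', ⟨hs, hx⟩, ⟨hs', hx'⟩, hc, hne⟩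
    have hmem : ∀ (k : ℕ) (s : Multiset ℕ), (∀ i ∈ s, i ≤ N) →
        ∀ a ∈ Multiset.replicate k b + s.map ν, a ∈ insert b (ν '' Set.Iic N) := by
      intro k s hs a ha
      rcases Multiset.mem_add.1 ha with ha | ha
      · exact Or.inl (Multiset.eq_of_mem_replicate ha)
      · obtain ⟨i, hi, rfl⟩ := Multiset.mem_map.1 ha
        exact Or.inr ⟨i, hs i hi, rfl⟩
    rw [← h.sum_eq k hs] at hx
    rw [← h.sum_eq k' hs'] at hx'
    exact ⟨_, _, hmem k s hs, hmem k' s' hs', (Nat.cast_inj.1 hx).symm, (Nat.cast_inj.1 hx').symm,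
      fun he => hne (h.index_injective hs hs' he), by simpa using hc⟩

theorem add_mem_sameLengthSet (h : IsProgressionSemigroup S N ν p ε b) {x y : ℕ}
    (hx : x ∈ sameLengthSet S) (hy : y ∈ S) : x + y ∈ sameLengthSet S := by
  rw [h.mem_sameLengthSet_iff] at hx ⊢
  obtain ⟨k, s, k', s', ⟨hs, hx⟩, ⟨hs', hx'⟩, hc, hne⟩ := hx
  obtain ⟨l, t, ht, hy⟩ := h.mem_iff.1 hy
  refine ⟨k + l, s + t, k' + l, s' + t, ⟨?_, ?_⟩, ⟨?_, ?_⟩, ?_, ?_⟩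
  · intro i hi
    rcases Multiset.mem_add.1 hi with hi | hi
    exacts [hs i hi, ht i hi]
  · simp only [Multiset.card_add, Multiset.sum_add, Nat.cast_add]
    rw [hx, hy]; ring
  · intro i hi
    rcases Multiset.mem_add.1 hi with hi | hi
    exacts [hs' i hi, ht i hi]
  · simp only [Multiset.card_add, Multiset.sum_add, Nat.cast_add]
    rw [hx', hy]; ring
  · simp only [Multiset.card_add]; omega
  · rintro ⟨h1, h2⟩
    exact hne ⟨by omega, add_right_cancel h2⟩

theorem exchangeablePairs_subset (h : IsProgressionSemigroup S N ν p ε b) :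
    exchangeablePairs N ν ⊆ sameLengthSet S := by
  rintro x ⟨i, hi, j, hj, h2, hN, rfl⟩
  rw [h.mem_sameLengthSet_iff]
  have hrep : ∀ i' ≤ N, ∀ j' ≤ N, i' + j' = i + j →
      IsProgressionRep N p ε b (ν i + ν j) 0 {i', j'} := by
    intro i' hi' j' hj' hij
    refine ⟨by simp [hi', hj'], ?_⟩
    have : ((i' : ℤ) + j') = i + j := by exact_mod_cast hij
    push_cast [h.val i hi, h.val j hj]
    simp
    linear_combination (-ε) * this
  have key : ∀ i' ≤ N, ∀ j' ≤ N, i' + j' = i + j → i' ≠ i → i' ≠ j → ∃ k s k' s',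
      IsProgressionRep N p ε b (ν i + ν j) k s ∧ IsProgressionRep N p ε b (ν i + ν j) k' s' ∧
      k + Multiset.card s = k' + Multiset.card s' ∧ ¬ (k = k' ∧ s = s') := by
    intro i' hi' j' hj' hij h1 h2
    refine ⟨0, {i, j}, 0, {i', j'}, hrep i hi j hj rfl, hrep i' hi' j' hj' hij, by simp, ?_⟩
    rintro ⟨-, he⟩
    have : i' ∈ ({i, j} : Multiset ℕ) := by rw [he]; simp
    simp [h1, h2] at this
  -- Indices at distance at least 2 move one step inward; closer ones move outward, where the bounds
  -- on i + j leave room.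
  by_cases h1 : i + 2 ≤ j
  · exact key (i + 1) (by omega) (j - 1) (by omega) (by omega) (by omega) (by omega)
  by_cases h3 : j + 2 ≤ i
  · exact key (i - 1) (by omega) (j + 1) (by omega) (by omega) (by omega) (by omega)
  by_cases h4 : i ≤ j
  · exact key (i - 1) (by omega) (j + 1) (by omega) (by omega) (by omega) (by omega)
  · exact key (i + 1) (by omega) (j - 1) (by omega) (by omega) (by omega) (by omega)

theorem mem_sameLengthSet_of_rep (h : IsProgressionSemigroup S N ν p ε b) {x K : ℕ}
    {s s' : Multiset ℕ} (hs : IsProgressionRep N p ε b x 0 s)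
    (hs' : IsProgressionRep N p ε b x K s') (hK : 0 < K)
    (hc : Multiset.card s = K + Multiset.card s') : x ∈ sameLengthSet S := by
  rw [h.mem_sameLengthSet_iff]
  exact ⟨0, s, K, s', hs, hs', by omega, fun h => by omega⟩

theorem mem_exchangeablePairs_add (h : IsProgressionSemigroup S N ν p ε b) {x k i j : ℕ}
    {u : Multiset ℕ} (hx : IsProgressionRep N p ε b x k (i ::ₘ j ::ₘ u))
    (h2 : 2 ≤ i + j) (hN : i + j ≤ 2 * N - 2) :
    x ∈ exchangeablePairs N ν + (S : Set ℕ) := by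
  obtain ⟨hs, hx⟩ := hx
  have hi := hs i (by simp)
  have hj := hs j (by simp)
  have hu : ∀ i ∈ u, i ≤ N := fun i hi => hs i (by simp [hi])
  refine ⟨ν i + ν j, ⟨i, hi, j, hj, h2, hN, rfl⟩, (Multiset.replicate k b + u.map ν).sum,
    h.mem_iff.2 ⟨k, u, hu, h.sum_eq k hu⟩, ?_⟩
  apply Nat.cast_injective (R := ℤ)
  simp only [Nat.cast_add, hx]
  rw [h.val i hi, h.val j hj]
  have := h.sum_eq k hu
  rw [this]
  simp; ring

/-- An element of `sameLengthSet S` that is not an exchangeable pair plus an element of `S` has two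
factorizations of the same length with a different number of copies of `b`. -/
theorem exists_reps (h : IsProgressionSemigroup S N ν p ε b) (hN : 1 ≤ N) {δ γ : ℤ} {e' : ℕ}
    (hδ : δ ≠ 0) (hb : (b : ℤ) = p + δ * γ) (hε : ε = δ * e') (hγ : IsCoprime γ e') {x : ℕ}
    (hx : x ∈ sameLengthSet S) (hxH : x ∉ exchangeablePairs N ν + (S : Set ℕ)) :
    ∃ k t s s', 0 < t ∧ IsProgressionRep N p ε b x k s ∧
      IsProgressionRep N p ε b x (k + e' * t) s' ∧
      Multiset.card s = Multiset.card s' + e' * t ∧ (s'.sum : ℤ) + t * γ = s.sum := by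
  have key : ∀ k s k' s', IsProgressionRep N p ε b x k s → IsProgressionRep N p ε b x k' s' →
      k + Multiset.card s = k' + Multiset.card s' → k < k' → ∃ k t s s', 0 < t ∧
      IsProgressionRep N p ε b x k s ∧ IsProgressionRep N p ε b x (k + e' * t) s' ∧
      Multiset.card s = Multiset.card s' + e' * t ∧ (s'.sum : ℤ) + t * γ = s.sum := by
    intro k s k' s' hr hr' hc hlt
    obtain ⟨K, rfl⟩ := Nat.exists_eq_add_of_lt hlt
    have h1 := hr.2
    rw [hr'.2] at h1
    have hcz : (Multiset.card s : ℤ) = Multiset.card s' + (K + 1) := by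
      have : Multiset.card s = Multiset.card s' + (K + 1) := by omega
      exact_mod_cast this
    -- The common length cancels every p; coprimality then makes e' divide K + 1, the excess of
    -- copies of b.
    have h2 : ((K : ℤ) + 1) * γ = (s.sum - s'.sum) * e' := by
      apply mul_left_cancel₀ hδ
      simp only [Nat.cast_add, Nat.cast_one] at h1
      rw [hb, hcz, hε] at h1
      linear_combination h1
    have h3 : (e' : ℤ) ∣ (K : ℤ) + 1 := by
      apply hγ.symm.dvd_of_dvd_mul_right
      rw [h2]; exact dvd_mul_left _ _
    have h4 : e' ∣ K + 1 := by exact_mod_cast h3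
    obtain ⟨t, ht⟩ := h4
    have he' : (e' : ℤ) ≠ 0 := by
      rintro he
      exact h.step_ne (by rw [hε, he, mul_zero])
    refine ⟨k, t, s, s', ?_, hr, ?_, by omega, ?_⟩
    · rcases Nat.eq_zero_or_pos t with rfl | h0
      · simp at ht
      · exact h0
    · rw [← ht]; exact hr'
    · have ht' : (K : ℤ) + 1 = e' * t := by exact_mod_cast ht
      rw [ht'] at h2
      apply mul_left_cancel₀ he'
      linear_combination h2
  obtain ⟨k, s, k', s', hr, hr', hc, hne⟩ := h.mem_sameLengthSet_iff.1 hx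
  rcases lt_trichotomy k k' with hlt | rfl | hlt
  · exact key k s k' s' hr hr' hc hlt
  · exfalso
    have hsum : s.sum = s'.sum := by
      have h1 := hr.2
      rw [hr'.2, show Multiset.card s = Multiset.card s' by omega] at h1
      have := mul_right_cancel₀ h.step_ne (add_left_cancel h1)
      exact_mod_cast this.symm
    obtain ⟨i, j, u, rfl, h2, h3⟩ := Multiset.exists_pair_of_ne hN hr.1 hr'.1 (by omega) hsum
      fun he => hne ⟨rfl, he⟩
    exact hxH (h.mem_exchangeablePairs_add hr h2 h3)
  · exact key k' s' k s hr' hr hc.symm hlt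

/-- Since c ≤ Ne', some e' indices sum to c, and the corresponding terms add up to e'b. -/
theorem sameLengthSet_eq_of_interior (h : IsProgressionSemigroup S N ν p ε b) (hN : 1 ≤ N)
    {δ : ℤ} {c e' : ℕ} (hδ : δ ≠ 0) (hb : (b : ℤ) = p + δ * c) (hε : ε = δ * e')
    (hc : IsCoprime (c : ℤ) e') (hcN : c ≤ N * e') :
    sameLengthSet S = (exchangeablePairs N ν + (S : Set ℕ)) ∪ ({e' * b} + (S : Set ℕ)) := by
  ext x
  constructor
  · intro hx
    by_cases hxH : x ∈ exchangeablePairs N ν + (S : Set ℕ)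
    · exact Or.inl hxH
    right
    obtain ⟨k, t, s, s', ht, -, hr', -, -⟩ := h.exists_reps hN hδ hb hε hc hx hxH
    obtain ⟨t, rfl⟩ := Nat.exists_eq_add_of_lt ht
    refine ⟨e' * b, rfl, _, h.mem_iff.2 ⟨k + e' * t, s', hr'.1, h.sum_eq _ hr'.1⟩, ?_⟩
    apply Nat.cast_injective (R := ℤ)
    simp only [Nat.cast_add, hr'.2]
    rw [h.sum_eq _ hr'.1]
    push_cast; ring
  · rintro (⟨y, hy, z, hz, rfl⟩ | ⟨y, rfl, z, hz, rfl⟩)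
    · exact h.add_mem_sameLengthSet (h.exchangeablePairs_subset hy) hz
    · refine h.add_mem_sameLengthSet ?_ hz
      obtain ⟨s, hs, hcard, hsum⟩ := Multiset.exists_card_sum_eq e' c hcN
      refine h.mem_sameLengthSet_of_rep (K := e') (s := s) (s' := 0) ⟨hs, ?_⟩ ⟨by simp, by simp⟩ ?_
        (by simp [hcard])
      · rw [hcard, hsum, hε]; push_cast; rw [hb]; ring
      · rcases Nat.eq_zero_or_pos e' with rfl | h0
        · exact absurd (by simpa using hε) h.step_ne
        · exact h0

theorem mem_mul_add_of_le (h : IsProgressionSemigroup S N ν p ε b) {x k B : ℕ} {s : Multiset ℕ}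
    (hx : IsProgressionRep N p ε b x k s) (hB : B ≤ s.count 0) :
    x ∈ ({B * ν 0} + (S : Set ℕ) : Set ℕ) := by
  obtain ⟨u, rfl⟩ := Multiset.le_iff_exists_add.1 (Multiset.le_count_iff_replicate_le.1 hB)
  obtain ⟨hs, hx⟩ := hx
  have hu : ∀ i ∈ u, i ≤ N := fun i hi => hs i (by simp [hi])
  refine ⟨B * ν 0, rfl, _, h.mem_iff.2 ⟨k, u, hu, h.sum_eq k hu⟩, ?_⟩
  apply Nat.cast_injective (R := ℤ)
  simp only [Nat.cast_add, hx, Nat.cast_mul]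
  rw [h.sum_eq k hu, h.val 0 (Nat.zero_le _)]
  simp; ring

theorem mem_mul_add_one_add (h : IsProgressionSemigroup S N ν p ε b) {x k B : ℕ}
    {s : Multiset ℕ} (hx : IsProgressionRep N p ε b x k s) (h1 : s.sum = 1)
    (hB : B + 1 ≤ Multiset.card s) :
    x ∈ ({B * ν 0 + ν 1} + (S : Set ℕ) : Set ℕ) := by
  have h1s : 1 ∈ s := by
    by_contra hn
    have := Multiset.sum_le_card_nsmul s 0 fun i hi => by
      have := Multiset.single_le_sum (by simp) i hi
      have : i ≠ 1 := fun h => hn (h ▸ hi)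
      omega
    simp at this; omega
  obtain ⟨t, rfl⟩ := Multiset.exists_cons_of_mem h1s
  have ht := t.card_le_count_zero_add_sum
  rw [Multiset.sum_cons] at h1
  rw [Multiset.card_cons] at hB
  obtain ⟨u, rfl⟩ := Multiset.le_iff_exists_add.1
    (Multiset.le_count_iff_replicate_le.1 (show B ≤ t.count 0 by omega))
  obtain ⟨hs, hx⟩ := hx
  have hu : ∀ i ∈ u, i ≤ N := fun i hi => hs i (by simp [hi])
  refine ⟨B * ν 0 + ν 1, rfl, _, h.mem_iff.2 ⟨k, u, hu, h.sum_eq k hu⟩, ?_⟩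
  apply Nat.cast_injective (R := ℤ)
  simp only [Nat.cast_add, hx, Nat.cast_mul]
  rw [h.sum_eq k hu, h.val 0 (Nat.zero_le _), h.val 1 (hs 1 (by simp))]
  simp; ring

/-- The relation sum s' = sum s + tc bounds the cardinality of s' from below by Q, hence that of s
by e' + Q. Avoiding exchangeable pairs makes almost every index in s zero. -/
theorem mem_of_exterior (h : IsProgressionSemigroup S N ν p ε b) (hN : 1 ≤ N)
    {δ : ℤ} {c e' Q : ℕ} (hδ : δ ≠ 0) (hb : (b : ℤ) = p - δ * c) (hε : ε = δ * e')
    (hc : IsCoprime (c : ℤ) e') (hc0 : 0 < c) (hQ : N * Q < c + N) {x : ℕ}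
    (hx : x ∈ sameLengthSet S) (hxH : x ∉ exchangeablePairs N ν + (S : Set ℕ)) :
    x ∈ ({(e' + Q) * ν 0} + (S : Set ℕ) : Set ℕ) ∨
      ¬ N ∣ c ∧ x ∈ ({(e' + Q - 1) * ν 0 + ν 1} + (S : Set ℕ) : Set ℕ) := by
  obtain ⟨k, t, s, s', ht, hr, hr', hcard, hsum⟩ :=
    h.exists_reps hN hδ (γ := -c) (by rw [hb]; ring) hε hc.neg_left hx hxH
  have he' : 0 < e' := by
    rcases Nat.eq_zero_or_pos e' with rfl | h0
    · exact absurd (by simpa using hε) h.step_ne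
    · exact h0
  have hsum' : s'.sum = s.sum + t * c := by
    have : (s'.sum : ℤ) = s.sum + t * c := by linear_combination hsum
    exact_mod_cast this
  have hle := Multiset.sum_le_mul_card hr'.1
  have htc : c ≤ t * c := Nat.le_mul_of_pos_left _ ht
  have het : e' ≤ e' * t := Nat.le_mul_of_pos_right _ ht
  have hQ' : Q ≤ Multiset.card s' := by
    by_contra! hlt
    have := Nat.mul_le_mul_left N (show Multiset.card s' + 1 ≤ Q from hlt)
    rw [mul_add] at this; omega
  have hcnt := s.card_le_count_zero_add_sum
  have hs'pos : 0 < Multiset.card s' := by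
    rcases Nat.eq_zero_or_pos (Multiset.card s') with h0 | h0
    · rw [h0] at hle; omega
    · exact h0
  rcases (show N = 1 ∨ 2 ≤ N by omega) with rfl | hN2
  -- For N = 1, s has at least card s - sum s ≥ e' + c ≥ e' + Q zeros.
  · exact Or.inl (h.mem_mul_add_of_le hr (by omega))
  rcases Multiset.exists_pair_or_sum_extremal hN2 hr.1 (by omega) with
    ⟨i, j, u, rfl, h2, h3⟩ | h1 | h1
  · exact absurd (h.mem_exchangeablePairs_add hr h2 h3) hxH
  · rcases Nat.le_one_iff_eq_zero_or_eq_one.1 h1 with h0 | h1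
    · exact Or.inl (h.mem_mul_add_of_le hr (by omega))
    · by_cases hdvd : N ∣ c
      · left
        refine h.mem_mul_add_of_le hr ?_
        -- When c = Nq, the sum of s' is at least Nq + 1, which costs one more term and makes up for
        -- the single index 1 in s.
        have : Q + 1 ≤ Multiset.card s' := by
          obtain ⟨q, rfl⟩ := hdvd
          have hqQ : Q ≤ q := by
            by_contra! hlt
            have := Nat.mul_le_mul_left N (show q + 1 ≤ Q from hlt)
            rw [mul_add] at this; omega
          have := Nat.mul_le_mul_left N hqQ
          by_contra! hlt
          have := Nat.mul_le_mul_left N (show Multiset.card s' ≤ Q by omega)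
          omega
        omega
      · exact Or.inr ⟨hdvd, h.mem_mul_add_one_add hr h1 (by omega)⟩
  -- The sum of s is at most N * card s' - c, too small for the high extreme.
  · exfalso
    have := Nat.mul_le_mul_left N (show Multiset.card s' + 1 ≤ Multiset.card s by omega)
    rw [mul_add] at this; omega

/-- Because e'b = e'p - cε, adding Q terms with index sum c + r to e' copies of b gives (e' + Q)p +
rε. Used for r = 0 and r = 1; for r = 1, the room c + 1 ≤ NQ comes from N ∤ c. -/
theorem mul_mem_of_exterior (h : IsProgressionSemigroup S N ν p ε b)
    {δ : ℤ} {c e' Q r : ℕ} (hb : (b : ℤ) = p - δ * c) (hε : ε = δ * e') (hcr : c + r ≤ N * Q)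
    (hr : r ≤ N) (hQ : 0 < Q) : (e' + Q - 1) * ν 0 + ν r ∈ sameLengthSet S := by
  have he' : 0 < e' := by
    rcases Nat.eq_zero_or_pos e' with rfl | h0
    · exact absurd (by simpa using hε) h.step_ne
    · exact h0
  obtain ⟨s, hs, hcard, hsum⟩ := Multiset.exists_card_sum_eq Q (c + r) hcr
  obtain ⟨B, hB⟩ : ∃ B, e' + Q = B + 1 := ⟨e' + Q - 1, by omega⟩
  have hBz : (e' : ℤ) + Q = B + 1 := by exact_mod_cast hB
  rw [hB, Nat.add_sub_cancel]
  refine h.mem_sameLengthSet_of_rep (K := e') (s := r ::ₘ Multiset.replicate B 0) (s' := s)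
    ⟨?_, ?_⟩ ⟨hs, ?_⟩ he' (by simp [hcard, hB])
  · intro i hi
    rcases Multiset.mem_cons.1 hi with rfl | hi
    · exact hr
    · rw [Multiset.eq_of_mem_replicate hi]; omega
  · push_cast
    rw [h.val 0 (Nat.zero_le _), h.val r hr]
    simp; ring
  · rw [Nat.cast_add, Nat.cast_mul]
    rw [h.val 0 (Nat.zero_le _), h.val r hr, hcard, hsum, hb, hε]
    push_cast
    linear_combination (-p) * hBz

theorem sameLengthSet_eq_of_exterior (h : IsProgressionSemigroup S N ν p ε b) (hN : 1 ≤ N)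
    {δ : ℤ} {c e' Q : ℕ} (hδ : δ ≠ 0) (hb : (b : ℤ) = p - δ * c) (hε : ε = δ * e')
    (hc : IsCoprime (c : ℤ) e') (hc0 : 0 < c) (hcQ : c ≤ N * Q) (hQ : N * Q < c + N) :
    (N ∣ c → sameLengthSet S =
      (exchangeablePairs N ν + (S : Set ℕ)) ∪ ({(e' + Q) * ν 0} + (S : Set ℕ))) ∧
    (¬ N ∣ c → sameLengthSet S = (exchangeablePairs N ν + (S : Set ℕ)) ∪
      ({(e' + Q) * ν 0, (e' + Q - 1) * ν 0 + ν 1} + (S : Set ℕ))) := by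
  have hQ0 : 0 < Q := by
    rcases Nat.eq_zero_or_pos Q with rfl | h0
    · omega
    · exact h0
  have h0 : (e' + Q) * ν 0 ∈ sameLengthSet S := by
    have h1 := h.mul_mem_of_exterior (r := 0) hb hε hcQ (Nat.zero_le _) hQ0
    obtain ⟨B, hB⟩ : ∃ B, e' + Q = B + 1 := ⟨e' + Q - 1, by omega⟩
    rw [hB, Nat.add_sub_cancel] at h1
    rw [hB, add_mul, one_mul]; exact h1
  have hle : exchangeablePairs N ν + (S : Set ℕ) ⊆ sameLengthSet S := by
    rintro _ ⟨y, hy, z, hz, rfl⟩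
    exact h.add_mem_sameLengthSet (h.exchangeablePairs_subset hy) hz
  constructor
  · intro hdvd
    refine Set.Subset.antisymm (fun x hx => ?_) (Set.union_subset hle ?_)
    · by_cases hxH : x ∈ exchangeablePairs N ν + (S : Set ℕ)
      · exact Or.inl hxH
      · rcases h.mem_of_exterior hN hδ hb hε hc hc0 hQ hx hxH with h1 | h1
        · exact Or.inr h1
        · exact absurd hdvd h1.1
    · rintro _ ⟨y, rfl, z, hz, rfl⟩
      exact h.add_mem_sameLengthSet h0 hz
  · intro hdvd
    refine Set.Subset.antisymm (fun x hx => ?_) (Set.union_subset hle ?_)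
    · by_cases hxH : x ∈ exchangeablePairs N ν + (S : Set ℕ)
      · exact Or.inl hxH
      · right
        rcases h.mem_of_exterior hN hδ hb hε hc hc0 hQ hx hxH with h1 | h1
        · exact Set.add_subset_add_right (by simp) h1
        · exact Set.add_subset_add_right (by simp) h1.2
    · rintro _ ⟨y, rfl | rfl, z, hz, rfl⟩
      · exact h.add_mem_sameLengthSet h0 hz
      · refine h.add_mem_sameLengthSet (h.mul_mem_of_exterior hb hε ?_ hN hQ0) hz
        rcases hcQ.lt_or_eq with h1 | h1
        · exact h1
        · exact absurd ⟨Q, h1⟩ hdvd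

end IsProgressionSemigroup

/-! ### The progression read in both directions, and the floor β. -/

theorem isProgressionSemigroup_of_val {S : AddSubmonoid ℕ} {N : ℕ} {ν : ℕ → ℕ} {p ε : ℤ} {b : ℕ}
    (hε : ε ≠ 0) (hval : ∀ i ≤ N, (ν i : ℤ) = p + i * ε) (hb : b ∉ ν '' Set.Iic N)
    (hgen : IsMinimalGeneratingSet (insert b (ν '' Set.Iic N)) S) :
    IsProgressionSemigroup S N ν p ε b :=
  ⟨hε, hval, fun i hi h => hb ⟨i, hi, h⟩, atomsOf_eq_of_isMinimalGeneratingSet hgen, hgen.1⟩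

theorem image_add_one_Iic {n : ℕ} (hn : 2 ≤ n) (m : ℕ → ℕ) :
    (fun i => m (i + 1)) '' Set.Iic (n - 1) = m '' Set.Icc 1 n := by
  ext x
  constructor
  · rintro ⟨i, hi, rfl⟩
    exact ⟨i + 1, by simp at hi ⊢; omega, rfl⟩
  · rintro ⟨i, hi, rfl⟩
    simp at hi
    exact ⟨i - 1, by simp; omega, by simp only [Nat.sub_add_cancel hi.1]⟩

theorem image_sub_Iic {n : ℕ} (hn : 2 ≤ n) (m : ℕ → ℕ) :
    (fun i => m (n - i)) '' Set.Iic (n - 1) = m '' Set.Icc 1 n := by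
  ext x
  constructor
  · rintro ⟨i, hi, rfl⟩
    exact ⟨n - i, by simp at hi ⊢; omega, rfl⟩
  · rintro ⟨i, hi, rfl⟩
    simp at hi
    exact ⟨n - i, by simp; omega, by simp only [Nat.sub_sub_self hi.2]⟩

theorem exchangeablePairs_of_increasing {N a e : ℕ} {ν : ℕ → ℕ} (hν : ∀ i ≤ N, ν i = a + i * e) :
    exchangeablePairs N ν = {x | ∃ l : ℕ, 2 ≤ l ∧ l ≤ 2 * N - 2 ∧ x = 2 * a + l * e} := by
  ext x
  constructor
  · rintro ⟨i, hi, j, hj, h2, hN, rfl⟩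
    exact ⟨i + j, h2, hN, by rw [hν i hi, hν j hj]; ring⟩
  · rintro ⟨l, h2, hN, rfl⟩
    refine ⟨min l N, min_le_right _ _, l - min l N, by omega, by omega, by omega, ?_⟩
    rw [hν _ (min_le_right _ _), hν (l - min l N) (by omega)]
    have : l = min l N + (l - min l N) := by omega
    calc 2 * a + l * e = 2 * a + (min l N + (l - min l N)) * e := by rw [← this]
      _ = _ := by ring

theorem exchangeablePairs_reverse {N : ℕ} {ν : ℕ → ℕ} :
    exchangeablePairs N (fun i => ν (N - i)) = exchangeablePairs N ν := by
  ext x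
  constructor
  · rintro ⟨i, hi, j, hj, h2, hN, rfl⟩
    exact ⟨N - i, by omega, N - j, by omega, by omega, by omega, rfl⟩
  · rintro ⟨i, hi, j, hj, h2, hN, rfl⟩
    refine ⟨N - i, by omega, N - j, by omega, by omega, by omega, ?_⟩
    simp only [Nat.sub_sub_self hi, Nat.sub_sub_self hj]

/-- The quotient equals (Ne' + c - 1)/N, so its floor is e' + ⌊(c - 1)/N⌋ = e' + ⌈c/N⌉ - 1. -/
theorem exists_floor_add_one_eq {N c d e' β : ℕ} {D : ℚ} (hN : 1 ≤ N) (hc : 0 < c) (hd : 0 < d)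
    (hD : D = d * (N * e' + c)) (hβ : β = ⌊(D - d) / (d * (N : ℚ))⌋₊) :
    ∃ Q, β + 1 = e' + Q ∧ c ≤ N * Q ∧ N * Q < c + N := by
  obtain ⟨c, rfl⟩ := Nat.exists_eq_add_of_lt hc
  have hdq : (d : ℚ) ≠ 0 := by positivity
  have h1 : (D - d) / (d * (N : ℚ)) = ((N * e' + c : ℕ) : ℚ) / N := by
    rw [hD, show (d : ℚ) * (N * e' + ((0 + c + 1 : ℕ) : ℚ)) - d = d * ((N * e' + c : ℕ) : ℚ) by
      push_cast; ring, mul_div_mul_left _ _ hdq]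
  rw [h1, Nat.floor_div_eq_div, Nat.mul_add_div (by omega)] at hβ
  refine ⟨c / N + 1, by omega, ?_, ?_⟩
  · have := Nat.div_add_mod c N
    have := Nat.mod_lt c (show 0 < N by omega)
    rw [mul_add]; omega
  · have := Nat.div_add_mod c N
    rw [mul_add]; omega

theorem theorem5p2
    (n : ℕ) (hn : 2 ≤ n) (e : ℕ) (he : 0 < e)
    (m : ℕ → ℕ) (hm1 : 0 < m 1)
    (hm : ∀ i ∈ Set.Icc 1 n, m i = m 1 + (i - 1) * e)
    (b : ℕ) (hb : 0 < b) (hbm : b ∉ m '' Set.Icc 1 n)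
    (S : AddSubmonoid ℕ) (hS : IsNumericalSemigroup S)
    (hgen : IsMinimalGeneratingSet (generatorSet n m b) S)
    (mx mn : ℕ) (hmx : IsGreatest (generatorSet n m b) mx)
    (hmn : IsLeast (generatorSet n m b) mn)
    (d : ℕ) (hd : d = Int.gcd ((b : ℤ) - (m 1 : ℤ)) (e : ℤ))
    (β : ℕ) (hβ : β = ⌊((mx : ℚ) - mn - d) / (d * ((n : ℚ) - 1))⌋₊)
    (H : Set ℕ)
    (hH : H = {x | ∃ l : ℕ, 2 ≤ l ∧ l ≤ 2 * n - 4 ∧ x = 2 * m 1 + l * e} + (S : Set ℕ)) :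
    (d * (n - 1) ∣ mx - mn →
      (b = mn → sameLengthSet S = H ∪ ({(β + 1) * m 1} + (S : Set ℕ))) ∧
      (b = mx → sameLengthSet S = H ∪ ({(β + 1) * m n} + (S : Set ℕ)))) ∧
    (¬ d * (n - 1) ∣ mx - mn →
      (b = mn → sameLengthSet S =
        H ∪ ({(β + 1) * m 1, (β + 1) * m 1 + e} + (S : Set ℕ))) ∧
      (b = mx → sameLengthSet S =
        H ∪ ({(β + 1) * m n, (β + 1) * m n - e} + (S : Set ℕ)))) ∧
    (b ≠ mn → b ≠ mx → sameLengthSet S = H ∪ ({e / d * b} + (S : Set ℕ))) := by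
  obtain ⟨N, rfl⟩ : ∃ N, n = N + 1 := ⟨n - 1, by omega⟩
  have hN : 1 ≤ N := by omega
  have hup : ∀ i ≤ N, m (i + 1) = m 1 + i * e := fun i hi => by
    rw [hm (i + 1) (by simp; omega), Nat.add_sub_cancel]
  have hdown : ∀ i ≤ N, (m (N + 1 - i) : ℤ) = m (N + 1) + i * (-(e : ℤ)) := fun i hi => by
    rw [show N + 1 - i = N - i + 1 by omega, hup _ (by omega), hup N le_rfl]
    push_cast [hi]; ring
  have h1 : IsProgressionSemigroup S N (fun i => m (i + 1)) (m 1) e b := by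
    have him := image_add_one_Iic hn m
    rw [Nat.add_sub_cancel] at him
    refine isProgressionSemigroup_of_val (by exact_mod_cast he.ne')
      (fun i hi => by rw [hup i hi]; push_cast; ring) ?_ ?_
    · rwa [him]
    · rwa [him]
  have h2 : IsProgressionSemigroup S N (fun i => m (N + 1 - i)) (m (N + 1)) (-e) b := by
    have him := image_sub_Iic hn m
    rw [Nat.add_sub_cancel] at him
    refine isProgressionSemigroup_of_val (neg_ne_zero.2 (by exact_mod_cast he.ne')) hdown ?_ ?_
    · rwa [him]
    · rwa [him]
  have hH1 : H = exchangeablePairs N (fun i => m (i + 1)) + (S : Set ℕ) := by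
    rw [hH, exchangeablePairs_of_increasing hup, show 2 * (N + 1) - 4 = 2 * N - 2 by omega]
  have hH2 : H = exchangeablePairs N (fun i => m (N + 1 - i)) + (S : Set ℕ) := by
    rw [hH1, ← exchangeablePairs_reverse]
    congr 1
    ext x
    have : ∀ i ≤ N, m (N - i + 1) = m (N + 1 - i) := fun i hi => by
      rw [show N + 1 - i = N - i + 1 by omega]
    constructor
    · rintro ⟨i, hi, j, hj, h2, hN, rfl⟩
      exact ⟨i, hi, j, hj, h2, hN, by simp only [this i hi, this j hj]⟩
    · rintro ⟨i, hi, j, hj, h2, hN, rfl⟩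
      exact ⟨i, hi, j, hj, h2, hN, by simp only [this i hi, this j hj]⟩
  have hd0 : 0 < d := by
    rw [hd]; exact Int.gcd_pos_of_ne_zero_right _ (by exact_mod_cast he.ne')
  -- γ = (b - m_1)/d and e' = e/d; the position of b is read off from γ < 0, 0 < γ < Ne' or γ > Ne'.
  obtain ⟨γ, e', hcop, hbγ, hee'⟩ := Int.exists_gcd_one (hd ▸ hd0)
  rw [← hd] at hbγ hee'
  have hdz : (0 : ℤ) < d := by exact_mod_cast hd0
  have he'0 : 0 < e' := by
    have : (0 : ℤ) < e' * d := by rw [← hee']; exact_mod_cast he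
    exact pos_of_mul_pos_left this hdz.le
  lift e' to ℕ using he'0.le
  have hde : e = e' * d := by exact_mod_cast hee'
  have hcop' : IsCoprime γ (e' : ℤ) := Int.isCoprime_iff_gcd_eq_one.2 hcop
  have hmN := hup N le_rfl
  have hmem1 : m 1 ∈ generatorSet (N + 1) m b := Or.inr ⟨1, by simp, rfl⟩
  have hmemN : m (N + 1) ∈ generatorSet (N + 1) m b := Or.inr ⟨N + 1, by simp, rfl⟩
  have hbmem : b ∈ generatorSet (N + 1) m b := Or.inl rfl
  have hb1 : b ≠ m 1 := fun h => hbm ⟨1, by simp, h.symm⟩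
  have hbN : b ≠ m (N + 1) := fun h => hbm ⟨N + 1, by simp, h.symm⟩
  have hrange : ∀ x ∈ generatorSet (N + 1) m b, x = b ∨ m 1 ≤ x ∧ x ≤ m (N + 1) := by
    rintro x (rfl | ⟨i, hi, rfl⟩)
    · exact Or.inl rfl
    · right
      have hi' := hm i hi
      have : (i - 1) * e ≤ N * e := Nat.mul_le_mul_right _ (by simp at hi; omega)
      omega
  have hdvd : ∀ c : ℕ, mx = mn + d * (N * e' + c) → (d * (N + 1 - 1) ∣ mx - mn ↔ N ∣ c) := by
    intro c hc
    rw [hc, Nat.add_sub_cancel_left, Nat.add_sub_cancel, Nat.mul_dvd_mul_iff_left hd0,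
      Nat.dvd_add_right (Dvd.intro _ rfl)]
  have hfloor : ∀ c : ℕ, 0 < c → mx = mn + d * (N * e' + c) →
      ∃ Q, β + 1 = e' + Q ∧ c ≤ N * Q ∧ N * Q < c + N := by
    intro c hc0 hc
    refine exists_floor_add_one_eq (D := (mx : ℚ) - mn) hN hc0 hd0 ?_ ?_
    · rw [hc]; push_cast; ring
    · rw [hβ]; push_cast; rw [add_sub_cancel_right]
  have hlow : b = mn →
      (d * (N + 1 - 1) ∣ mx - mn → sameLengthSet S = H ∪ ({(β + 1) * m 1} + (S : Set ℕ))) ∧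
      (¬ d * (N + 1 - 1) ∣ mx - mn → sameLengthSet S =
        H ∪ ({(β + 1) * m 1, (β + 1) * m 1 + e} + (S : Set ℕ))) := by
    intro hbmn
    have hlt : b < m 1 := lt_of_le_of_ne (hbmn ▸ hmn.2 hmem1) hb1
    have hmxN : mx = m (N + 1) := by
      have := hmx.2 hmemN
      rcases hrange mx hmx.1 with h | h <;> omega
    have hγ : 0 < -γ := by
      have : (0 : ℤ) < (-γ) * d := by
        have : (b : ℤ) < m 1 := by exact_mod_cast hlt
        linarith
      exact pos_of_mul_pos_left this hdz.le
    obtain ⟨c, hcγ⟩ := Int.eq_ofNat_of_zero_le hγ.le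
    have hc0 : 0 < c := by omega
    have hbz : (b : ℤ) = m 1 - d * c := by rw [← hcγ]; linear_combination hbγ
    have hdiff : mx = mn + d * (N * e' + c) := by
      have : (mx : ℤ) = mn + d * (N * e' + c) := by
        rw [hmxN, ← hbmn, hbz, hmN, hde]; push_cast; ring
      exact_mod_cast this
    obtain ⟨Q, hβQ, hQ1, hQ2⟩ := hfloor c hc0 hdiff
    have hcc : IsCoprime (c : ℤ) e' := by rw [← hcγ]; exact hcop'.neg_left
    have := h1.sameLengthSet_eq_of_exterior hN hdz.ne' hbz (by rw [hee']; ring) hcc hc0 hQ1 hQ2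
    rw [hdvd c hdiff, hH1]
    rw [← hβQ] at this
    refine ⟨this.1, fun h => ?_⟩
    rw [this.2 h]
    simp only [Nat.add_sub_cancel, zero_add]
    rw [show m (1 + 1) = m 1 + e by rw [hup 1 hN, one_mul],
      show β * m 1 + (m 1 + e) = (β + 1) * m 1 + e by ring]
  have hhigh : b = mx →
      (d * (N + 1 - 1) ∣ mx - mn →
        sameLengthSet S = H ∪ ({(β + 1) * m (N + 1)} + (S : Set ℕ))) ∧
      (¬ d * (N + 1 - 1) ∣ mx - mn → sameLengthSet S =
        H ∪ ({(β + 1) * m (N + 1), (β + 1) * m (N + 1) - e} + (S : Set ℕ))) := by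
    intro hbmx
    have hlt : m (N + 1) < b := lt_of_le_of_ne (hbmx ▸ hmx.2 hmemN) hbN.symm
    have hmn1 : mn = m 1 := by
      have := hmn.2 hmem1
      rcases hrange mn hmn.1 with h | h <;> omega
    -- Measured from m_n with δ = -d, the offset of b is c = γ - Ne', still coprime to e'.
    have hγ : 0 < γ - N * e' := by
      have : (0 : ℤ) < (γ - N * e') * d := by
        have h3 : (m (N + 1) : ℤ) < b := by exact_mod_cast hlt
        rw [hmN, hde] at h3
        push_cast at h3
        linarith
      exact pos_of_mul_pos_left this hdz.le
    obtain ⟨c, hcγ⟩ := Int.eq_ofNat_of_zero_le hγ.le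
    have hc0 : 0 < c := by omega
    have hbz : (b : ℤ) = m (N + 1) - (-d) * c := by
      rw [← hcγ, hmN, hde]; push_cast; linear_combination hbγ
    have hdiff : mx = mn + d * (N * e' + c) := by
      have : (mx : ℤ) = mn + d * (N * e' + c) := by
        rw [hmn1, ← hbmx, hbz, hmN, hde]; push_cast; ring
      exact_mod_cast this
    obtain ⟨Q, hβQ, hQ1, hQ2⟩ := hfloor c hc0 hdiff
    have hcc : IsCoprime (c : ℤ) e' := by
      rw [← hcγ, sub_eq_add_neg, ← neg_mul]
      exact hcop'.add_mul_right_left _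
    have := h2.sameLengthSet_eq_of_exterior hN (neg_ne_zero.2 hdz.ne') hbz
      (by rw [hee']; ring) hcc hc0 hQ1 hQ2
    rw [hdvd c hdiff, hH2]
    rw [← hβQ] at this
    refine ⟨this.1, fun h => ?_⟩
    rw [this.2 h]
    simp only [Nat.add_sub_cancel, Nat.sub_zero]
    -- Hence e ≤ m_n, and the truncated subtraction of e in the statement is a genuine one.
    have hstep : m (N + 1) = m N + e := by
      have h3 := hup (N - 1) (by omega)
      rw [Nat.sub_add_cancel hN] at h3
      obtain ⟨K, rfl⟩ := Nat.exists_eq_add_of_le' hN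
      rw [hmN, h3, Nat.add_sub_cancel]; ring
    rw [show (β + 1) * m (N + 1) - e = β * m (N + 1) + m N by
      rw [add_mul, one_mul]; omega]
  refine ⟨fun h => ⟨fun hb => (hlow hb).1 h, fun hb => (hhigh hb).1 h⟩,
    fun h => ⟨fun hb => (hlow hb).2 h, fun hb => (hhigh hb).2 h⟩, fun hbmn hbmx => ?_⟩
  have hlt1 : m 1 < b := by
    have := hmn.2 hbmem
    rcases hrange mn hmn.1 with h | h <;> omega
  have hltN : b < m (N + 1) := by
    have := hmx.2 hbmem
    rcases hrange mx hmx.1 with h | h <;> omega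
  have hγ : 0 < γ := by
    have : (0 : ℤ) < γ * d := by
      have : (m 1 : ℤ) < b := by exact_mod_cast hlt1
      linarith
    exact pos_of_mul_pos_left this hdz.le
  lift γ to ℕ using hγ.le
  have hγN : γ ≤ N * e' := by
    have : (γ : ℤ) * d < (N * e') * d := by
      have h3 : (b : ℤ) < m (N + 1) := by exact_mod_cast hltN
      rw [hmN, hde] at h3
      push_cast at h3
      linarith
    have := lt_of_mul_lt_mul_right this hdz.le
    exact_mod_cast this.le
  rw [hH1, h1.sameLengthSet_eq_of_interior hN hdz.ne' (by linear_combination hbγ)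
    (by rw [hee']; ring) hcop' hγN, hde, Nat.mul_div_cancel _ hd0]
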